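/- Let $\mathcal F$ be a collection of symbols for (total) Type 2 computable functions $\mathbb R^n\to\mathbb R$ ($n\ge 0$), each symbol being given by a natural number of its own, so that sentences can be inputs of algorithms. Assume that $\mathcal F$ contains unary negation, addition, the absolute value and all rational constants. Here $f:\mathbb R^n\to\mathbb R$ is Type 2 computable if there is a function-oracle machine which, for all $\vec x\in\mathbb R^n$, every name $\gamma$ of $\vec x$ (a sequence of $n$-tuples $\gamma(i)$ of dyadic rationals with $|\gamma(i)_j-x_j|<2^{-i}$ for all $i,j$) as the oracle, and every input $i\in\mathbb N$, outputs a dyadic rational $d$ with $|d-f(\vec x)|<2^{-i}$. A bounded $\mathcal L_{\mathcal F}$-sentence is a sentence $$\varphi:\quad Q_1^{[u_1,v_1]}x_1\cdots Q_n^{[u_n,v_n]}x_n.\,\psi(x_1,\dots,x_n),\qquad Q_i\in\{\exists,\forall\},\ n\ge 0,$$ where $\psi$ is built with $\wedge,\vee$ from atomic formulas $t>0$ and $t\ge 0$, with $t$ a term over $\mathcal F$, the bounds $u_i,v_i$ are terms over $\mathcal F$ in the variables $x_1,\dots,x_{i-1}$, and $\exists^{[u,v]}x.\chi$, $\forall^{[u,v]}x.\chi$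 stand for $\exists x.(u\le x\wedge x\le v\wedge\chi)$, $\forall x.((u\le x\wedge x\le v)\rightarrow\chi)$. Truth is truth in $\mathbb R$. For rational $\delta>0$, the $\delta$-weakening $\varphi^{-\delta}$ is obtained from $\varphi$ by replacing every atomic formula $t>0$ of $\psi$ by $t>-\delta$ and every $t\ge 0$ of $\psi$ by $t\ge-\delta$; the bounds of the quantifiers are not changed. The sentence $\varphi$ is $\delta$-robust if $\varphi^{-\delta}\rightarrow\varphi$ is true. Let $L$ be a class of bounded $\mathcal L_{\mathcal F}$-sentences for which truth is undecidable, that is, no algorithm halts on every sentence of $L$ with the correct answer to whether it is true. Then, for every rational $\delta>0$, it is undecidable whether an arbitrary bounded $\mathcal L_{\mathcal F}$-sentence is $\delta$-robust: no algorithm halts on every bounded $\mathcal L_{\mathcal F}$-sentence with the correct answer. In particular, there is no algorithm that decides, given a rational $\delta>0$ and a bounded $\mathcal L_{\mathcal F}$-sentence $\varphi$, whether $\varphi$ is $\delta$-robust. -/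

import Mathlib

namespace DeltaRobust

/-! ### Type 2 computable real functions -/

/-- Programs of function-oracle machines: the partial recursive programs of
`Nat.Partrec.Code`, with one more instruction that queries the oracle. -/
inductive OracleCode : Type
  | zero : OracleCode
  | succ : OracleCode
  | left : OracleCode
  | right : OracleCode
  | oracle : OracleCode
  | pair : OracleCode → OracleCode → OracleCode
  | comp : OracleCode → OracleCode → OracleCode
  | prec : OracleCode → OracleCode → OracleCode
  | rfind' : OracleCode → OracleCode

/-- The partial function computed by an oracle program with oracle `g`. Apart from the oracle
query, the instructions mean the same as in `Nat.Partrec.Code.eval`. -/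
def OracleCode.eval (g : ℕ → ℕ) : OracleCode → ℕ →. ℕ
  | .zero => fun _ => Part.some 0
  | .succ => fun n => Part.some (n + 1)
  | .left => fun n => Part.some n.unpair.1
  | .right => fun n => Part.some n.unpair.2
  | .oracle => fun n => Part.some (g n)
  | .pair cf cg => fun n => Nat.pair <$> eval g cf n <*> eval g cg n
  | .comp cf cg => fun n => eval g cg n >>= eval g cf
  | .prec cf cg =>
    Nat.unpaired fun a n =>
      n.rec (eval g cf a) fun y IH => do
        let i ← IH
        eval g cg (Nat.pair a (Nat.pair y i))
  | .rfind' cf =>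
    Nat.unpaired fun a m =>
      (Nat.rfind fun n => (fun k => k = 0) <$> eval g cf (Nat.pair a (n + m))).map (· + m)

/-- The pair `(m, k)` represents the dyadic rational `m / 2 ^ k`. -/
noncomputable def dyadicVal (d : ℤ × ℕ) : ℝ := (d.1 : ℝ) / 2 ^ d.2

/-- `γ` is a name of the point `x` of `ℝⁿ`: its `i`-th entry approximates every coordinate of `x`
by a dyadic rational with error less than `2 ^ (-i)`. -/
def IsName {n : ℕ} (γ : ℕ → Fin n → ℤ × ℕ) (x : Fin n → ℝ) : Prop :=
  ∀ i j, |dyadicVal (γ i j) - x j| < 1 / 2 ^ i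

/-- A name as a function oracle: the query `i` is answered by the (coded) tuple `γ i`. -/
def nameOracle {n : ℕ} (γ : ℕ → Fin n → ℤ × ℕ) : ℕ → ℕ :=
  fun i => Encodable.encode (List.ofFn (γ i))

/-- Type 2 computability of a total function `f : ℝⁿ → ℝ`: one oracle program which, for every
point `x`, every name of `x` as the oracle, and every input `i`, halts and outputs a dyadic
rational with distance less than `2 ^ (-i)` from `f x`. -/
def Type2Computable {n : ℕ} (f : (Fin n → ℝ) → ℝ) : Prop :=
  ∃ c : OracleCode, ∀ (x : Fin n → ℝ) (γ : ℕ → Fin n → ℤ × ℕ), IsName γ x →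
    ∀ i : ℕ, ∃ d : ℤ × ℕ,
      Encodable.encode d ∈ c.eval (nameOracle γ) i ∧ |dyadicVal d - f x| < 1 / 2 ^ i

/-! ### The language -/

universe u v

/-- The function symbols of `L`, with their interpretation over `ℝ`, are a collection of Type 2
computable functions which contains unary negation, addition, the absolute value and all rational
constants (in particular the constant `0`). The order is not a symbol of `L`: it is built into the
atomic formulas below. -/
structure ComputableSignature (L : FirstOrder.Language.{u, v}) [L.Structure ℝ] where
  computable : ∀ (n : ℕ) (f : L.Functions n),
    Type2Computable (fun x : Fin n → ℝ => FirstOrder.Language.Structure.funMap f x)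
  neg : L.Functions 1
  add : L.Functions 2
  abs : L.Functions 1
  const : ℚ → L.Functions 0
  funMap_neg : ∀ x : Fin 1 → ℝ, FirstOrder.Language.Structure.funMap neg x = -x 0
  funMap_add : ∀ x : Fin 2 → ℝ, FirstOrder.Language.Structure.funMap add x = x 0 + x 1
  funMap_abs : ∀ x : Fin 1 → ℝ, FirstOrder.Language.Structure.funMap abs x = |x 0|
  funMap_const : ∀ (q : ℚ) (x : Fin 0 → ℝ), FirstOrder.Language.Structure.funMap (const q) x = (q : ℝ)

/-- Quantifier-free formulas in the variables `x₀, …, xₙ₋₁`: positive Boolean combinations of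
atomic formulas `t > 0` and `t ≥ 0`. -/
inductive QFFormula (L : FirstOrder.Language.{u, v}) (n : ℕ) : Type u
  | pos : L.Term (Fin n) → QFFormula L n
  | nonneg : L.Term (Fin n) → QFFormula L n
  | and : QFFormula L n → QFFormula L n → QFFormula L n
  | or : QFFormula L n → QFFormula L n → QFFormula L n

/-- Bounded prenex formulas with the free variables `x₀, …, xₙ₋₁`. The quantifiers `ex u v φ` and
`all u v φ` bind the variable `xₙ` of `φ` and restrict it to `[u, v]`; the terms `u` and `v` may
use the variables `x₀, …, xₙ₋₁` only. -/
inductive BoundedFormula (L : FirstOrder.Language.{u, v}) : ℕ → Type u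
  | matrix {n : ℕ} : QFFormula L n → BoundedFormula L n
  | ex {n : ℕ} : L.Term (Fin n) → L.Term (Fin n) → BoundedFormula L (n + 1) → BoundedFormula L n
  | all {n : ℕ} : L.Term (Fin n) → L.Term (Fin n) → BoundedFormula L (n + 1) → BoundedFormula L n

/-- Bounded sentences `Q₁^[u₁,v₁] x₁ ⋯ Qₙ^[uₙ,vₙ] xₙ. ψ(x₁, …, xₙ)`. -/
abbrev BoundedSentence (L : FirstOrder.Language.{u, v}) : Type u := BoundedFormula L 0

variable {L : FirstOrder.Language.{u, v}}

/-! ### Semantics over the reals -/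

/-- Truth of a quantifier-free formula at the point `x`. -/
def QFFormula.Realize [L.Structure ℝ] {n : ℕ} (x : Fin n → ℝ) : QFFormula L n → Prop
  | .pos t => t.realize x > 0
  | .nonneg t => t.realize x ≥ 0
  | .and φ ψ => φ.Realize x ∧ ψ.Realize x
  | .or φ ψ => φ.Realize x ∨ ψ.Realize x

/-- Truth of a bounded formula at the point `x`. -/
def BoundedFormula.Realize [L.Structure ℝ] : {n : ℕ} → BoundedFormula L n → (Fin n → ℝ) → Prop
  | _, .matrix ψ, x => ψ.Realize x
  | _, .ex u v φ, x =>
    ∃ a : ℝ, u.realize x ≤ a ∧ a ≤ v.realize x ∧ φ.Realize (Fin.snoc x a : Fin (_ + 1) → ℝ)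
  | _, .all u v φ, x =>
    ∀ a : ℝ, (u.realize x ≤ a ∧ a ≤ v.realize x) → φ.Realize (Fin.snoc x a : Fin (_ + 1) → ℝ)

/-- Truth of a bounded sentence in the real structure. -/
def BoundedFormula.IsTrue [L.Structure ℝ] (φ : BoundedSentence L) : Prop :=
  φ.Realize Fin.elim0

/-! ### Weakening and robustness -/

/-- The term `t - (-δ)`, that is `t + (-(-δ))`; so `t > -δ` abbreviates `t - (-δ) > 0`. -/
def ComputableSignature.shift [L.Structure ℝ] (S : ComputableSignature L) (δ : ℚ) {n : ℕ}
    (t : L.Term (Fin n)) : L.Term (Fin n) :=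
  .func S.add ![t, .func S.neg ![.func (S.const (-δ)) ![] ] ]

/-- Replace `t > 0` by `t > -δ` and `t ≥ 0` by `t ≥ -δ`. -/
def QFFormula.weaken [L.Structure ℝ] (S : ComputableSignature L) (δ : ℚ) {n : ℕ} :
    QFFormula L n → QFFormula L n
  | .pos t => .pos (S.shift δ t)
  | .nonneg t => .nonneg (S.shift δ t)
  | .and φ ψ => .and (φ.weaken S δ) (ψ.weaken S δ)
  | .or φ ψ => .or (φ.weaken S δ) (ψ.weaken S δ)

/-- The `δ`-weakening: the atomic formulas of the matrix are weakened, the bounds of the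
quantifiers are kept. -/
def BoundedFormula.weaken [L.Structure ℝ] (S : ComputableSignature L) (δ : ℚ) :
    {n : ℕ} → BoundedFormula L n → BoundedFormula L n
  | _, .matrix ψ => .matrix (ψ.weaken S δ)
  | _, .ex u v φ => .ex u v (φ.weaken S δ)
  | _, .all u v φ => .all u v (φ.weaken S δ)

/-- `φ` is `δ`-robust if its `δ`-weakening implies `φ`. -/
def BoundedFormula.IsRobust [L.Structure ℝ] (S : ComputableSignature L) (δ : ℚ)
    (φ : BoundedSentence L) : Prop :=
  (φ.weaken S δ).IsTrue → φ.IsTrue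

/-! ### Sentences as inputs of algorithms -/

section Coding

variable [Encodable (Σ n, L.Functions n)]

/-- A term as the list of its symbols in Polish notation, each symbol given by its number. -/
def termCode {n : ℕ} (t : L.Term (Fin n)) : List ℕ :=
  t.listEncode.map Encodable.encode

/-- A quantifier-free formula in Polish notation: `inl true` and `inl false` stand for `∧` and `∨`,
and `inr (true, t)`, `inr (false, t)` for the atomic formulas `t > 0`, `t ≥ 0`. -/
def QFFormula.code {n : ℕ} : QFFormula L n → List (Bool ⊕ (Bool × List ℕ))
  | .pos t => [Sum.inr (true, termCode t)]
  | .nonneg t => [Sum.inr (false, termCode t)]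
  | .and φ ψ => Sum.inl true :: (φ.code ++ ψ.code)
  | .or φ ψ => Sum.inl false :: (φ.code ++ ψ.code)

/-- The finite objects that algorithms get in place of bounded formulas: a quantifier prefix
and a matrix. -/
abbrev FormulaCode : Type :=
  List (Bool × List ℕ × List ℕ) × List (Bool ⊕ (Bool × List ℕ))

/-- The code of a bounded formula. In the prefix, `true` stands for `∃` and `false` for `∀`. -/
def BoundedFormula.code : {n : ℕ} → BoundedFormula L n → FormulaCode
  | _, .matrix ψ => ([], ψ.code)
  | _, .ex u v φ => ((true, termCode u, termCode v) :: φ.code.1, φ.code.2)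
  | _, .all u v φ => ((false, termCode u, termCode v) :: φ.code.1, φ.code.2)

theorem termCode_injective {n : ℕ} :
    Function.Injective (termCode : L.Term (Fin n) → List ℕ) := fun _ _ h =>
  FirstOrder.Language.Term.listEncode_injective
    (List.map_injective_iff.2 Encodable.encode_injective h)

theorem QFFormula.code_append_inj {n : ℕ} (φ ψ : QFFormula L n)
    (l l' : List (Bool ⊕ (Bool × List ℕ))) (h : φ.code ++ l = ψ.code ++ l') :
    φ = ψ ∧ l = l' := by
  induction φ generalizing ψ l l' with
  | pos t => cases ψ <;> simp_all [QFFormula.code, termCode_injective.eq_iff]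
  | nonneg t => cases ψ <;> simp_all [QFFormula.code, termCode_injective.eq_iff]
  | and φ₁ φ₂ ih₁ ih₂ =>
    cases ψ <;> simp [QFFormula.code] at h
    obtain ⟨rfl, h₂⟩ := ih₁ _ _ _ h
    obtain ⟨rfl, rfl⟩ := ih₂ _ _ _ h₂
    exact ⟨rfl, rfl⟩
  | or φ₁ φ₂ ih₁ ih₂ =>
    cases ψ <;> simp [QFFormula.code] at h
    obtain ⟨rfl, h₂⟩ := ih₁ _ _ _ h
    obtain ⟨rfl, rfl⟩ := ih₂ _ _ _ h₂
    exact ⟨rfl, rfl⟩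

/-- Different formulas have different codes. -/
theorem BoundedFormula.code_injective {n : ℕ} :
    Function.Injective (BoundedFormula.code : BoundedFormula L n → FormulaCode) := by
  intro φ ψ h
  induction φ with
  | matrix φ =>
    cases ψ <;> simp [BoundedFormula.code] at h
    exact congrArg _ (QFFormula.code_append_inj _ _ [] [] (by simpa using h)).1
  | ex u v φ ih =>
    cases ψ <;> simp [BoundedFormula.code, termCode_injective.eq_iff] at h
    obtain ⟨⟨⟨rfl, rfl⟩, h₁⟩, h₂⟩ := h
    rw [ih (Prod.ext h₁ h₂)]
  | all u v φ ih =>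
    cases ψ <;> simp [BoundedFormula.code, termCode_injective.eq_iff] at h
    obtain ⟨⟨⟨rfl, rfl⟩, h₁⟩, h₂⟩ := h
    rw [ih (Prod.ext h₁ h₂)]

end Coding

/-- It is decidable whether an arbitrary member `a` of `A` has the property `P`: there is an
algorithm which halts on the code of every member `a` of `A` and answers correctly whether `P a`
holds. (Nothing is asked of its behaviour on other inputs.) -/
def DecidableOn {α σ : Type*} [Primcodable σ] (code : α → σ) (A : Set α) (P : α → Prop) : Prop :=
  ∃ f : σ →. Bool, Partrec f ∧ ∀ a ∈ A, ∃ b ∈ f (code a), (b = true ↔ P a)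

/-- A rational number, given by numerator and denominator, together with a formula. -/
def pairCode [Encodable (Σ n, L.Functions n)] (p : ℚ × BoundedSentence L) :
    (ℤ × ℕ) × FormulaCode :=
  ((p.1.num, p.1.den), p.2.code)

end DeltaRobust

namespace DeltaRobust

universe u v

variable {L : FirstOrder.Language.{u, v}}

open FirstOrder.Language

/-! ### Weakening variables -/

/-! Truth reduces to `δ`-robustness: each sentence `φ` is turned, computably, into an equivalent
sentence whose `δ`-weakening is always true. The latter is `δ`-robust exactly when `φ` is true.

Clipping makes the weakened atoms true. With `-δ/2 < k < 0`, the value `2 max(t, k)` is positive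
(nonnegative) exactly when `t` is, but after adding `δ` it is at least `2k + δ > 0`. The identity `2
max(t, k) = t + k + |t - k|` writes it with addition, negation, absolute value and a constant;
keeping the factor 2 avoids a division.

Weakening does not touch the quantifier bounds, so an empty existential range could still make the
weakened sentence false. Hence `guard` first replaces `[u, v]` by the nonempty `[u, u + |v - u|]`
and moves the condition `u ≤ v` into the matrix, where it is clipped as well.
`BoundedFormula.realize_guard` and `BoundedFormula.realize_clip` give the equivalence,
`BoundedFormula.RangesNonempty.realize_weaken_clip` the truth of the weakening. On Polish codes the
whole transformation is primitive recursive (`primrec_reduceCode`,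
`BoundedFormula.code_clip_guard`). -/

/-- A quantifier-free formula, read with one more variable. -/
def QFFormula.lift {n : ℕ} : QFFormula L n → QFFormula L (n + 1)
  | .pos t => .pos (t.relabel Fin.castSucc)
  | .nonneg t => .nonneg (t.relabel Fin.castSucc)
  | .and φ ψ => .and φ.lift ψ.lift
  | .or φ ψ => .or φ.lift ψ.lift

theorem QFFormula.realize_lift [L.Structure ℝ] {n : ℕ} (φ : QFFormula L n) (x : Fin n → ℝ)
    (a : ℝ) : φ.lift.Realize (Fin.snoc x a : Fin (n + 1) → ℝ) ↔ φ.Realize x := by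
  induction φ with
  | pos t => simp [lift, Realize]
  | nonneg t => simp [lift, Realize]
  | and φ ψ ih₁ ih₂ => simp [lift, Realize, ih₁, ih₂]
  | or φ ψ ih₁ ih₂ => simp [lift, Realize, ih₁, ih₂]

/-! ### Conjunctions and disjunctions with the matrix -/

/-- The conjunction (`true`) or disjunction (`false`) of two quantifier-free formulas. -/
def QFFormula.bin {n : ℕ} : Bool → QFFormula L n → QFFormula L n → QFFormula L n
  | true => .and
  | false => .or

/-- Join a quantifier-free formula to the matrix of a bounded formula, by a conjunction (`true`)
or a disjunction (`false`). -/
def BoundedFormula.push (b : Bool) : {n : ℕ} → QFFormula L n → BoundedFormula L n →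
    BoundedFormula L n
  | _, g, .matrix ψ => .matrix (.bin b g ψ)
  | _, g, .ex u v φ => .ex u v (φ.push b g.lift)
  | _, g, .all u v φ => .all u v (φ.push b g.lift)

/-- The ranges of all quantifiers are nonempty, whatever the values of the free variables. -/
def BoundedFormula.RangesNonempty [L.Structure ℝ] : {n : ℕ} → BoundedFormula L n → Prop
  | _, .matrix _ => True
  | _, .ex u v φ => (∀ x : Fin _ → ℝ, u.realize x ≤ v.realize x) ∧ φ.RangesNonempty
  | _, .all u v φ => (∀ x : Fin _ → ℝ, u.realize x ≤ v.realize x) ∧ φ.RangesNonempty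

theorem BoundedFormula.RangesNonempty.push [L.Structure ℝ] (b : Bool) {n : ℕ} (g : QFFormula L n)
    {φ : BoundedFormula L n} (h : φ.RangesNonempty) : (φ.push b g).RangesNonempty := by
  induction φ with
  | matrix ψ => trivial
  | ex u v φ ih => exact ⟨h.1, ih _ h.2⟩
  | all u v φ ih => exact ⟨h.1, ih _ h.2⟩

/-- A conjunct always passes through `∃`; nonemptiness is needed for `∀`, which over an empty range
would lose the conjunct. -/
theorem BoundedFormula.RangesNonempty.realize_push_true [L.Structure ℝ] {n : ℕ}
    (g : QFFormula L n) {φ : BoundedFormula L n} (h : φ.RangesNonempty) (x : Fin n → ℝ) :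
    (φ.push true g).Realize x ↔ g.Realize x ∧ φ.Realize x := by
  induction φ with
  | matrix ψ => rfl
  | ex u v φ ih =>
    simp only [BoundedFormula.push, Realize, ih _ h.2, QFFormula.realize_lift]
    exact ⟨fun ⟨a, h₁, h₂, h₃, h₄⟩ => ⟨h₃, a, h₁, h₂, h₄⟩,
      fun ⟨h₃, a, h₁, h₂, h₄⟩ => ⟨a, h₁, h₂, h₃, h₄⟩⟩
  | all u v φ ih =>
    simp only [BoundedFormula.push, Realize, ih _ h.2, QFFormula.realize_lift]
    -- The left endpoint of the range is the point at which `g` is read off.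
    exact ⟨fun H => ⟨(H _ ⟨le_rfl, h.1 x⟩).1, fun a ha => (H a ha).2⟩,
      fun H a ha => ⟨H.1, H.2 a ha⟩⟩

/-- Dual situation: `∀` is harmless, while `∃` needs a point in its range even when `g` alone is
true. -/
theorem BoundedFormula.RangesNonempty.realize_push_false [L.Structure ℝ] {n : ℕ}
    (g : QFFormula L n) {φ : BoundedFormula L n} (h : φ.RangesNonempty) (x : Fin n → ℝ) :
    (φ.push false g).Realize x ↔ g.Realize x ∨ φ.Realize x := by
  induction φ with
  | matrix ψ => rfl
  | ex u v φ ih =>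
    simp only [BoundedFormula.push, Realize, ih _ h.2, QFFormula.realize_lift]
    constructor
    · rintro ⟨a, h₁, h₂, h₃ | h₃⟩
      · exact .inl h₃
      · exact .inr ⟨a, h₁, h₂, h₃⟩
    · rintro (h₃ | ⟨a, h₁, h₂, h₃⟩)
      · exact ⟨_, le_rfl, h.1 x, .inl h₃⟩
      · exact ⟨a, h₁, h₂, .inr h₃⟩
  | all u v φ ih =>
    simp only [BoundedFormula.push, Realize, ih _ h.2, QFFormula.realize_lift]
    constructor
    · intro H
      by_cases hg : g.Realize x
      · exact .inl hg
      · exact .inr fun a ha => (H a ha).resolve_left hg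
    · rintro (H | H) a ha
      · exact .inl H
      · exact .inr (H a ha)

/-! ### Terms -/

section Terms

variable [L.Structure ℝ] (S : ComputableSignature L) {n : ℕ}

/-- The term `s + t`. -/
def ComputableSignature.addT (s t : L.Term (Fin n)) : L.Term (Fin n) := .func S.add ![s, t]

/-- The term `s - t`, that is `s + (-t)`. -/
def ComputableSignature.subT (s t : L.Term (Fin n)) : L.Term (Fin n) :=
  S.addT s (.func S.neg ![t])

/-- The term `|t|`. -/
def ComputableSignature.absT (t : L.Term (Fin n)) : L.Term (Fin n) := .func S.abs ![t]

/-- The rational constant `q` as a term. -/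
def ComputableSignature.constT (q : ℚ) : L.Term (Fin n) := .func (S.const q) ![]

/-- The term `u + |v - u|`: a bound which is never less than `u`, and equals `v` if `u ≤ v`. -/
def ComputableSignature.upper (u v : L.Term (Fin n)) : L.Term (Fin n) :=
  S.addT u (S.absT (S.subT v u))

/-- The term `t + k + |t - k|`, whose value is `2 max(t, k)`. -/
def ComputableSignature.clip (k : ℚ) (t : L.Term (Fin n)) : L.Term (Fin n) :=
  S.addT (S.addT t (S.constT k)) (S.absT (S.subT t (S.constT k)))

variable (x : Fin n → ℝ)

@[simp] theorem ComputableSignature.realize_addT (s t : L.Term (Fin n)) :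
    (S.addT s t).realize x = s.realize x + t.realize x := by
  simp [addT, S.funMap_add]

@[simp] theorem ComputableSignature.realize_subT (s t : L.Term (Fin n)) :
    (S.subT s t).realize x = s.realize x - t.realize x := by
  simp [subT, S.funMap_neg, sub_eq_add_neg]

@[simp] theorem ComputableSignature.realize_absT (t : L.Term (Fin n)) :
    (S.absT t).realize x = |t.realize x| := by
  simp [absT, S.funMap_abs]

@[simp] theorem ComputableSignature.realize_constT (q : ℚ) :
    (S.constT q : L.Term (Fin n)).realize x = q := by
  simp [constT, S.funMap_const]

theorem ComputableSignature.realize_shift (δ : ℚ) (t : L.Term (Fin n)) :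
    (S.shift δ t).realize x = t.realize x + δ := by
  simp [shift, S.funMap_add, S.funMap_neg, S.funMap_const]

theorem ComputableSignature.le_realize_upper (u v : L.Term (Fin n)) :
    u.realize x ≤ (S.upper u v).realize x := by
  simp [upper]

theorem ComputableSignature.realize_upper_of_le {u v : L.Term (Fin n)}
    (h : u.realize x ≤ v.realize x) : (S.upper u v).realize x = v.realize x := by
  simp [upper, abs_of_nonneg (sub_nonneg.2 h)]

theorem ComputableSignature.realize_clip (k : ℚ) (t : L.Term (Fin n)) :
    (S.clip k t).realize x = 2 * max (t.realize x) k := by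
  have h := max_sub_min_eq_abs' (t.realize x) (k : ℝ)
  have h' := max_add_min (t.realize x) (k : ℝ)
  simp only [clip, realize_addT, realize_absT, realize_subT, realize_constT]
  linarith

theorem ComputableSignature.realize_clip_pos {k : ℚ} (hk : k < 0) (t : L.Term (Fin n)) :
    0 < (S.clip k t).realize x ↔ 0 < t.realize x := by
  have hk' : ¬ (0 : ℝ) < k := by exact_mod_cast hk.not_gt
  simp [realize_clip, hk']

theorem ComputableSignature.realize_clip_nonneg {k : ℚ} (hk : k < 0) (t : L.Term (Fin n)) :
    0 ≤ (S.clip k t).realize x ↔ 0 ≤ t.realize x := by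
  have hk' : ¬ (0 : ℝ) ≤ k := by exact_mod_cast hk.not_ge
  simp [realize_clip, hk']

theorem ComputableSignature.realize_shift_clip_pos {k δ : ℚ} (h : 0 < 2 * k + δ)
    (t : L.Term (Fin n)) : 0 < (S.shift δ (S.clip k t)).realize x := by
  have h' : (0 : ℝ) < 2 * k + δ := by exact_mod_cast h
  rw [realize_shift, realize_clip]
  linarith [le_max_right (t.realize x) (k : ℝ)]

end Terms

/-! ### Clipping the atomic formulas -/

section Clip

variable [L.Structure ℝ] (S : ComputableSignature L)

/-- Replace the term `t` of every atomic formula by `2 max(t, k)`. -/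
def QFFormula.clip (k : ℚ) {n : ℕ} : QFFormula L n → QFFormula L n
  | .pos t => .pos (S.clip k t)
  | .nonneg t => .nonneg (S.clip k t)
  | .and φ ψ => .and (φ.clip k) (ψ.clip k)
  | .or φ ψ => .or (φ.clip k) (ψ.clip k)

/-- Replace the term `t` of every atomic formula of the matrix by `2 max(t, k)`. -/
def BoundedFormula.clip (k : ℚ) : {n : ℕ} → BoundedFormula L n → BoundedFormula L n
  | _, .matrix ψ => .matrix (ψ.clip S k)
  | _, .ex u v φ => .ex u v (φ.clip k)
  | _, .all u v φ => .all u v (φ.clip k)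

theorem QFFormula.realize_clip {k : ℚ} (hk : k < 0) {n : ℕ} (φ : QFFormula L n)
    (x : Fin n → ℝ) : (φ.clip S k).Realize x ↔ φ.Realize x := by
  induction φ with
  | pos t => exact S.realize_clip_pos x hk t
  | nonneg t => exact S.realize_clip_nonneg x hk t
  | and φ ψ ih₁ ih₂ => simp [clip, Realize, ih₁, ih₂]
  | or φ ψ ih₁ ih₂ => simp [clip, Realize, ih₁, ih₂]

theorem BoundedFormula.realize_clip {k : ℚ} (hk : k < 0) {n : ℕ} (φ : BoundedFormula L n)
    (x : Fin n → ℝ) : (φ.clip S k).Realize x ↔ φ.Realize x := by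
  induction φ with
  | matrix ψ => exact ψ.realize_clip S hk x
  | ex u v φ ih => simp [clip, Realize, ih]
  | all u v φ ih => simp [clip, Realize, ih]

/-- Every weakened atom holds at every point, and the matrix has no negations, so all combinations
hold too. -/
theorem QFFormula.realize_weaken_clip {k δ : ℚ} (h : 0 < 2 * k + δ) {n : ℕ} (φ : QFFormula L n)
    (x : Fin n → ℝ) : ((φ.clip S k).weaken S δ).Realize x := by
  induction φ with
  | pos t => exact S.realize_shift_clip_pos x h t
  | nonneg t => exact (S.realize_shift_clip_pos x h t).le
  | and φ ψ ih₁ ih₂ => exact ⟨ih₁, ih₂⟩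
  | or φ ψ ih₁ ih₂ => exact .inl ih₁

theorem BoundedFormula.RangesNonempty.realize_weaken_clip {k δ : ℚ} (hδ : 0 < 2 * k + δ) {n : ℕ}
    {φ : BoundedFormula L n} (h : φ.RangesNonempty) (x : Fin n → ℝ) :
    ((φ.clip S k).weaken S δ).Realize x := by
  induction φ with
  | matrix ψ => exact ψ.realize_weaken_clip S hδ x
  | ex u v φ ih => exact ⟨_, le_rfl, h.1 x, ih h.2 _⟩
  | all u v φ ih => exact fun a _ => ih h.2 _

end Clip

/-! ### Making the ranges of the quantifiers nonempty -/

section Guard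

variable [L.Structure ℝ] (S : ComputableSignature L)

/-- An equivalent formula in which the range `[u, v]` of every quantifier is replaced by the
nonempty range `[u, u + |v - u|]`, the condition `u ≤ v` being moved to the matrix. -/
def BoundedFormula.guard : {n : ℕ} → BoundedFormula L n → BoundedFormula L n
  | _, .matrix ψ => .matrix ψ
  | _, .ex u v φ => .ex u (S.upper u v) (φ.guard.push true (QFFormula.nonneg (S.subT v u)).lift)
  | _, .all u v φ => .all u (S.upper u v) (φ.guard.push false (QFFormula.pos (S.subT u v)).lift)

theorem BoundedFormula.rangesNonempty_guard {n : ℕ} (φ : BoundedFormula L n) :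
    (φ.guard S).RangesNonempty := by
  induction φ with
  | matrix ψ => trivial
  | ex u v φ ih => exact ⟨fun x => S.le_realize_upper x u v, ih.push _ _⟩
  | all u v φ ih => exact ⟨fun x => S.le_realize_upper x u v, ih.push _ _⟩

/-- If `u ≤ v`, the new range is `[u, v]` and the guard is neutral. If `v < u`, the guard makes `∃`
false and `∀` true, just as the empty range did. The guard can sink to the matrix because the inner
ranges are already nonempty. -/
theorem BoundedFormula.realize_guard {n : ℕ} (φ : BoundedFormula L n) (x : Fin n → ℝ) :
    (φ.guard S).Realize x ↔ φ.Realize x := by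
  induction φ with
  | matrix ψ => rfl
  | ex u v φ ih =>
    simp only [guard, Realize, (φ.rangesNonempty_guard S).realize_push_true,
      QFFormula.realize_lift, QFFormula.Realize, S.realize_subT, ih, ge_iff_le, sub_nonneg]
    constructor
    · rintro ⟨a, h₁, h₂, h₃, h₄⟩
      exact ⟨a, h₁, by rwa [S.realize_upper_of_le x h₃] at h₂, h₄⟩
    · rintro ⟨a, h₁, h₂, h₃⟩
      have h := h₁.trans h₂
      exact ⟨a, h₁, by rwa [S.realize_upper_of_le x h], h, h₃⟩
  | all u v φ ih =>
    simp only [guard, Realize, (φ.rangesNonempty_guard S).realize_push_false,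
      QFFormula.realize_lift, QFFormula.Realize, S.realize_subT, ih, gt_iff_lt, sub_pos]
    constructor
    · rintro H a ⟨h₁, h₂⟩
      have h := h₁.trans h₂
      exact (H a ⟨h₁, by rwa [S.realize_upper_of_le x h]⟩).resolve_left h.not_gt
    · rintro H a ⟨h₁, h₂⟩
      rcases lt_or_ge (v.realize x) (u.realize x) with h | h
      · exact .inl h
      · exact .inr (H a ⟨h₁, by rwa [S.realize_upper_of_le x h] at h₂⟩)

/-- The sentence to which the truth of `φ` is reduced is `δ`-robust if and only if `φ` is true,
since its `δ`-weakening is true in any case. -/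
theorem BoundedFormula.isRobust_clip_guard_iff {δ : ℚ} (hδ : 0 < δ) (φ : BoundedSentence L) :
    BoundedFormula.IsRobust S δ ((φ.guard S).clip S (-δ / 4)) ↔ φ.IsTrue := by
  -- The choice `k = -δ/4` leaves a margin of `δ/2`; any `k` strictly between `-δ/2` and `0` would
  -- do.
  have h : 0 < 2 * (-δ / 4) + δ := by linarith
  have hw : (((φ.guard S).clip S (-δ / 4)).weaken S δ).IsTrue :=
    (φ.rangesNonempty_guard S).realize_weaken_clip S h _
  have ht : ((φ.guard S).clip S (-δ / 4)).IsTrue ↔ φ.IsTrue :=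
    (BoundedFormula.realize_clip S (by linarith) _ _).trans (φ.realize_guard S _)
  exact ⟨fun H => ht.1 (H hw), fun H _ => ht.2 H⟩

end Guard

/-! ### The reduction on codes -/

section Codes

/-- The Polish notation of `s - t`, where `add` and `neg` are the numbers of the symbols. -/
def subCode (add neg : ℕ) (s t : List ℕ) : List ℕ := add :: (s ++ neg :: t)

/-- The Polish notation of `u + |v - u|`. -/
def upperCode (add neg abs : ℕ) (u v : List ℕ) : List ℕ :=
  add :: (u ++ abs :: subCode add neg v u)

/-- The Polish notation of `t + k + |t - k|`. -/
def clipCode (add neg abs k : ℕ) (t : List ℕ) : List ℕ :=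
  add :: (add :: (t ++ [k]) ++ abs :: subCode add neg t [k])

/-- The effect of clipping on a symbol of the code of the matrix. -/
def clipSymbol (add neg abs k : ℕ) (a : Bool ⊕ (Bool × List ℕ)) : Bool ⊕ (Bool × List ℕ) :=
  Sum.casesOn a Sum.inl fun p => Sum.inr (p.1, clipCode add neg abs k p.2)

/-- The range `[u, v]` of a quantifier becomes `[u, u + |v - u|]`. -/
def guardQuantifier (add neg abs : ℕ) (q : Bool × List ℕ × List ℕ) : Bool × List ℕ × List ℕ :=
  (q.1, q.2.1, upperCode add neg abs q.2.1 q.2.2)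

/-- What a quantifier contributes to the code of the matrix. -/
def guardSymbols (add neg : ℕ) (q : Bool × List ℕ × List ℕ) : List (Bool ⊕ (Bool × List ℕ)) :=
  [Sum.inl q.1, bif q.1 then Sum.inr (false, subCode add neg q.2.2 q.2.1)
    else Sum.inr (true, subCode add neg q.2.1 q.2.2)]

/-- The reduction on codes. -/
def reduceCode (add neg abs k : ℕ) (c : FormulaCode) : FormulaCode :=
  (c.1.map (guardQuantifier add neg abs),
    (c.1.flatMap (guardSymbols add neg) ++ c.2).map (clipSymbol add neg abs k))

theorem primrec_subCode (add neg : ℕ) : Primrec₂ (subCode add neg) :=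
  Primrec.list_cons.comp (.const add)
    (Primrec.list_append.comp .fst (Primrec.list_cons.comp (.const neg) .snd))

theorem primrec_upperCode (add neg abs : ℕ) : Primrec₂ (upperCode add neg abs) :=
  Primrec.list_cons.comp (.const add) (Primrec.list_append.comp .fst
    (Primrec.list_cons.comp (.const abs) ((primrec_subCode add neg).comp .snd .fst)))

theorem primrec_clipCode (add neg abs k : ℕ) : Primrec (clipCode add neg abs k) :=
  Primrec.list_cons.comp (.const add) (Primrec.list_append.comp
    (Primrec.list_cons.comp (.const add) (Primrec.list_append.comp .id (.const [k])))
    (Primrec.list_cons.comp (.const abs) ((primrec_subCode add neg).comp .id (.const [k]))))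

theorem primrec_clipSymbol (add neg abs k : ℕ) : Primrec (clipSymbol add neg abs k) :=
  Primrec.sumCasesOn .id (Primrec.sumInl.comp Primrec.snd).to₂
    (Primrec.sumInr.comp (Primrec.pair (Primrec.fst.comp .snd)
      ((primrec_clipCode add neg abs k).comp (Primrec.snd.comp .snd)))).to₂

theorem primrec_guardQuantifier (add neg abs : ℕ) : Primrec (guardQuantifier add neg abs) :=
  Primrec.pair .fst (Primrec.pair (Primrec.fst.comp .snd)
    ((primrec_upperCode add neg abs).comp (Primrec.fst.comp .snd) (Primrec.snd.comp .snd)))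

theorem primrec_guardSymbols (add neg : ℕ) : Primrec (guardSymbols add neg) :=
  Primrec.list_cons.comp (Primrec.sumInl.comp .fst) (Primrec.list_cons.comp
    (Primrec.cond .fst
      (Primrec.sumInr.comp (Primrec.pair (.const false)
        ((primrec_subCode add neg).comp (Primrec.snd.comp .snd) (Primrec.fst.comp .snd))))
      (Primrec.sumInr.comp (Primrec.pair (.const true)
        ((primrec_subCode add neg).comp (Primrec.fst.comp .snd) (Primrec.snd.comp .snd)))))
    (.const []))

theorem primrec_reduceCode (add neg abs k : ℕ) : Primrec (reduceCode add neg abs k) :=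
  Primrec.pair (Primrec.list_map .fst ((primrec_guardQuantifier add neg abs).comp .snd).to₂)
    (Primrec.list_map
      (Primrec.list_append.comp
        (Primrec.list_flatMap .fst ((primrec_guardSymbols add neg).comp .snd).to₂) .snd)
      ((primrec_clipSymbol add neg abs k).comp .snd).to₂)

variable [Encodable (Σ n, L.Functions n)]

/-- The number of a function symbol in the codes of terms. -/
def symbolCode {n : ℕ} (f : L.Functions n) : ℕ :=
  Encodable.encode (Sum.inr ⟨n, f⟩ : Fin 0 ⊕ Σ n, L.Functions n)

/-- The number of a symbol does not depend on how many variables are in scope, so `symbolCode` may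
be computed over `Fin 0`. -/
theorem termCode_func {n m : ℕ} (f : L.Functions m) (ts : Fin m → L.Term (Fin n)) :
    termCode (.func f ts) =
      symbolCode f :: (List.finRange m).flatMap fun i => termCode (ts i) := by
  simp [termCode, Term.listEncode, List.map_flatMap, symbolCode]

/-- A variable is coded by its index, which `Fin.castSucc` preserves; lifting is therefore invisible
on codes. -/
theorem termCode_relabel_castSucc {n : ℕ} (t : L.Term (Fin n)) :
    termCode (t.relabel Fin.castSucc) = termCode t := by
  induction t with
  | var i => simp [termCode, Term.relabel, Term.listEncode]; rfl
  | func f ts ih => simp only [Term.relabel, termCode_func, ih]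

theorem QFFormula.code_lift {n : ℕ} (φ : QFFormula L n) : φ.lift.code = φ.code := by
  induction φ with
  | pos t => simp [lift, code, termCode_relabel_castSucc]
  | nonneg t => simp [lift, code, termCode_relabel_castSucc]
  | and φ ψ ih₁ ih₂ => simp [lift, code, ih₁, ih₂]
  | or φ ψ ih₁ ih₂ => simp [lift, code, ih₁, ih₂]

/-- As `g` becomes the left operand, Polish notation only prepends the connective and `g` to the
matrix. -/
theorem BoundedFormula.code_push (b : Bool) {n : ℕ} (g : QFFormula L n)
    (φ : BoundedFormula L n) :
    (φ.push b g).code = (φ.code.1, Sum.inl b :: (g.code ++ φ.code.2)) := by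
  induction φ with
  | matrix ψ => cases b <;> rfl
  | ex u v φ ih => simp [push, code, ih, QFFormula.code_lift]
  | all u v φ ih => simp [push, code, ih, QFFormula.code_lift]

variable [L.Structure ℝ] (S : ComputableSignature L)

theorem ComputableSignature.termCode_addT {n : ℕ} (s t : L.Term (Fin n)) :
    termCode (S.addT s t) = symbolCode S.add :: (termCode s ++ termCode t) := by
  simp [addT, termCode_func, List.finRange_succ]

theorem ComputableSignature.termCode_absT {n : ℕ} (t : L.Term (Fin n)) :
    termCode (S.absT t) = symbolCode S.abs :: termCode t := by
  simp [absT, termCode_func, List.finRange_succ]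

theorem ComputableSignature.termCode_subT {n : ℕ} (s t : L.Term (Fin n)) :
    termCode (S.subT s t) =
      subCode (symbolCode S.add) (symbolCode S.neg) (termCode s) (termCode t) := by
  simp [subT, subCode, termCode_addT, termCode_func, List.finRange_succ]

theorem ComputableSignature.termCode_constT {n : ℕ} (q : ℚ) :
    termCode (S.constT q : L.Term (Fin n)) = [symbolCode (S.const q)] := by
  simp [constT, termCode_func]

theorem ComputableSignature.termCode_upper {n : ℕ} (u v : L.Term (Fin n)) :
    termCode (S.upper u v) = upperCode (symbolCode S.add) (symbolCode S.neg) (symbolCode S.abs)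
      (termCode u) (termCode v) := by
  simp [upper, upperCode, termCode_addT, termCode_absT, termCode_subT]

theorem ComputableSignature.termCode_clip {n : ℕ} (k : ℚ) (t : L.Term (Fin n)) :
    termCode (S.clip k t) = clipCode (symbolCode S.add) (symbolCode S.neg) (symbolCode S.abs)
      (symbolCode (S.const k)) (termCode t) := by
  simp [clip, clipCode, termCode_addT, termCode_absT, termCode_subT, termCode_constT]

theorem QFFormula.code_clip (k : ℚ) {n : ℕ} (φ : QFFormula L n) :
    (φ.clip S k).code = φ.code.map (clipSymbol (symbolCode S.add) (symbolCode S.neg)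
      (symbolCode S.abs) (symbolCode (S.const k))) := by
  induction φ with
  | pos t => simp [clip, code, clipSymbol, S.termCode_clip]
  | nonneg t => simp [clip, code, clipSymbol, S.termCode_clip]
  | and φ ψ ih₁ ih₂ => simp [clip, code, clipSymbol, ih₁, ih₂]
  | or φ ψ ih₁ ih₂ => simp [clip, code, clipSymbol, ih₁, ih₂]

theorem BoundedFormula.code_clip (k : ℚ) {n : ℕ} (φ : BoundedFormula L n) :
    (φ.clip S k).code = (φ.code.1, φ.code.2.map (clipSymbol (symbolCode S.add)
      (symbolCode S.neg) (symbolCode S.abs) (symbolCode (S.const k)))) := by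
  induction φ with
  | matrix ψ => simp [clip, code, QFFormula.code_clip]
  | ex u v φ ih => simp [clip, code, ih]
  | all u v φ ih => simp [clip, code, ih]

/-- The guards line up in the order of the prefix, so a `flatMap` suffices. The bit of a quantifier
serves also as the bit of its connective: `∃` goes with `∧`, `∀` with `∨`. -/
theorem BoundedFormula.code_guard {n : ℕ} (φ : BoundedFormula L n) :
    (φ.guard S).code =
      (φ.code.1.map (guardQuantifier (symbolCode S.add) (symbolCode S.neg) (symbolCode S.abs)),
        φ.code.1.flatMap (guardSymbols (symbolCode S.add) (symbolCode S.neg)) ++ φ.code.2) := by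
  induction φ with
  | matrix ψ => simp [guard, code]
  | ex u v φ ih =>
    simp [guard, code, code_push, ih, QFFormula.code_lift, QFFormula.code, guardQuantifier,
      guardSymbols, S.termCode_upper, S.termCode_subT]
  | all u v φ ih =>
    simp [guard, code, code_push, ih, QFFormula.code_lift, QFFormula.code, guardQuantifier,
      guardSymbols, S.termCode_upper, S.termCode_subT]

theorem BoundedFormula.code_clip_guard (k : ℚ) {n : ℕ} (φ : BoundedFormula L n) :
    ((φ.guard S).clip S k).code = reduceCode (symbolCode S.add) (symbolCode S.neg)
      (symbolCode S.abs) (symbolCode (S.const k)) φ.code := by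
  rw [code_clip, code_guard, reduceCode]

end Codes

/-! ### Undecidability -/

/-- Decidability is inherited along a reduction which is computable on codes. -/
theorem DecidableOn.of_reduction {α β σ τ : Type*} [Primcodable σ] [Primcodable τ]
    {code : α → σ} {code' : β → τ} {A : Set α} {B : Set β} {P : α → Prop} {Q : β → Prop}
    (h : DecidableOn code' B Q) {r : σ → τ} (hr : Computable r) (F : α → β)
    (hF : ∀ a ∈ A, F a ∈ B) (hcode : ∀ a ∈ A, code' (F a) = r (code a))
    (hPQ : ∀ a ∈ A, (Q (F a) ↔ P a)) : DecidableOn code A P := by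
  obtain ⟨f, hf, H⟩ := h
  refine ⟨fun a => f (r a), hf.comp hr, fun a ha => ?_⟩
  obtain ⟨b, hb, hbQ⟩ := H _ (hF a ha)
  exact ⟨b, by rwa [hcode a ha] at hb, hbQ.trans (hPQ a ha)⟩

/-- Since `δ` is fixed, the number of the constant `-δ/4` enters the reduction as a fixed numeral,
so it need not be computed from `δ`. -/
theorem not_decidableOn_isRobust [L.Structure ℝ] [Encodable (Σ n, L.Functions n)]
    (S : ComputableSignature L) (C : Set (BoundedSentence L))
    (hC : ¬ DecidableOn BoundedFormula.code C fun φ => φ.IsTrue) {δ : ℚ} (hδ : 0 < δ) :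
    ¬ DecidableOn BoundedFormula.code (Set.univ : Set (BoundedSentence L))
      fun φ => φ.IsRobust S δ := fun h =>
  hC <| h.of_reduction (primrec_reduceCode _ _ _ _).to_comp
    (fun φ => (φ.guard S).clip S (-δ / 4)) (fun _ _ => Set.mem_univ _)
    (fun φ _ => φ.code_clip_guard S _)
    (fun φ _ => BoundedFormula.isRobust_clip_guard_iff S hδ φ)

end DeltaRobust

theorem mainTheorem7 (L : FirstOrder.Language) [L.Structure ℝ]
    [Encodable (Σ n, L.Functions n)] (S : DeltaRobust.ComputableSignature L)
    (C : Set (DeltaRobust.BoundedSentence L))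
    (hC : ¬ DeltaRobust.DecidableOn DeltaRobust.BoundedFormula.code C
      (fun φ => φ.IsTrue)) :
    (∀ δ : ℚ, 0 < δ →
      ¬ DeltaRobust.DecidableOn DeltaRobust.BoundedFormula.code
        (Set.univ : Set (DeltaRobust.BoundedSentence L)) (fun φ => φ.IsRobust S δ)) ∧
    ¬ DeltaRobust.DecidableOn DeltaRobust.pairCode
      {p : ℚ × DeltaRobust.BoundedSentence L | 0 < p.1} (fun p => p.2.IsRobust S p.1) := by
  refine ⟨fun δ hδ => DeltaRobust.not_decidableOn_isRobust S C hC hδ, fun h =>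
    DeltaRobust.not_decidableOn_isRobust S C hC one_pos ?_⟩
  -- A uniform algorithm would decide the case `δ = 1`, by pairing each code with the fixed code of
  -- `1`.
  exact h.of_reduction (r := fun c => (((1 : ℚ).num, (1 : ℚ).den), c))
    ((Computable.const _).pair .id) (fun φ => (1, φ)) (fun _ _ => one_pos (α := ℚ))
    (fun _ _ => rfl) (fun _ _ => Iff.rfl)
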